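/- Theorem. Let $\mathcal D$ be the space of continuous linear functionals on the space of entire functions $f:\mathbb C\to\mathbb C$ (topologised by uniform convergence on compact sets), with the strong topology, i.e. uniform convergence on bounded sets of entire functions. For $\tau\in\mathbb C$, $\ell\ge 0$ let $\delta^{(\ell)}(x-\tau)\in\mathcal D$ be the functional $f\mapsto f^{(\ell)}(\tau)$. For $w=(x_1,\dots,x_r)\in\mathbb C^r$ let $V_w\subset\mathcal D$ be the linear span of all $\delta^{(\ell)}(x-\tau)$, where $\tau$ is a coordinate of $w$ and $0\le\ell<\#\{i: x_i=\tau\}$, and let $\mathcal P_r=\{(w,g): w\in\mathbb C^r,\ g\in V_w\}$ with the topology induced from $\mathbb C^r\times\mathcal D$. For a nonempty $X=\{n_1<\dots<n_\alpha\}\subseteq\{1,\dots,r\}$ let $\Delta_X(w)\in\mathcal D$ be the divided difference at $y_i=x_{n_i}$ (repetitions allowed): $\Delta_X(w)f$ is the last coefficient $c_\alpha$ in the Newton form $P=\sum_{j=1}^{\alpha}c_j\prod_{i<j}(x-y_i)$ of the Hermite interpolation polynomial $P$ of $f$ at $y_1,\dots,y_\alpha$, i.e. of the polynomial of degree less than $\alpha$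 with $P^{(\ell)}(y_j)=f^{(\ell)}(y_j)$ for $1\le j\le\alpha$, $0\le\ell<\#\{i:y_i=y_j\}$. A configuration $\mathcal C=\{X_j\}_{j=1}^{s}$ is a partition of $\{1,\dots,r\}$ into nonempty disjoint blocks. With $X_j=\{n^j_1<\dots<n^j_{d_j}\}$ and $X_{j,m}=\{n^j_1,\dots,n^j_m\}$, put $\mathcal B_{\mathcal C}(w)=\{\Delta_{X_{j,m}}(w)\}_{1\le j\le s,\,1\le m\le d_j}$. A point $w$ is subordinated to $\mathcal C$ if, whenever $x_k=x_l$ with $k\ne l$, the indices $k$ and $l$ lie in the same block of $\mathcal C$. Call a family $\{B_i(w)\}_i$ a continuous family of bases on a set $U\subseteq\mathbb C^r$ if for every $w\in U$ it is a basis of $V_w$, and for each $i$ the map $w\mapsto(w,B_i(w))$ is a continuous section $U\to\mathcal P_r$. Let $w_0\in\mathbb C^r$ and let $\mathcal C$ be a configuration. Then: (1) $\mathcal B_{\mathcal C}(w_0)$ is a basis of $V_{w_0}$ if and only if $w_0$ is subordinated to $\mathcal C$. (2) If $w_0$ is subordinated to $\mathcal C$, then $\mathcal B_{\mathcal C}(w)$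 is a continuous family of bases on some open neighbourhood $U$ of $w_0$. (3) With $N_j=\{1,\dots,j\}$, the Newton family $\{\Delta_{N_j}(w)\}_{j=1}^r$ is a continuous family of bases on all of $\mathbb C^r$; it is the special case of one block: if $\{1,\dots,r\}$ is the only block of $\mathcal C$, then, up to reindexing, the sets $X_{j,m}$ are the $N_j$ and $\mathcal B_{\mathcal C}(w)=\{\Delta_{N_j}(w)\}_{j=1}^{r}$. -/

import Mathlib

set_option maxSynthPendingDepth 3

open Polynomial Topology

noncomputable section

/-- The space of entire functions, with the topology inherited from `C(ℂ, ℂ)`, i.e. the topology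
of uniform convergence on compact sets. -/
def EntireFunctions : Submodule ℂ C(ℂ, ℂ) where
  carrier := {f | Differentiable ℂ f}
  add_mem' := fun hf hg => hf.add hg
  zero_mem' := differentiable_const (0 : ℂ)
  smul_mem' := fun c _ hf => hf.const_smul c

/-- Analytic functionals on `ℂ`: continuous linear functionals on the space of entire functions,
with the strong topology (uniform convergence on bounded sets of entire functions). -/
abbrev AnalyticFunctional : Type := StrongDual ℂ EntireFunctions

theorem contDiffAt_entire (f : EntireFunctions) (n : WithTop ℕ∞) (z : ℂ) :
    ContDiffAt ℂ n f.1 z :=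
  (Differentiable.contDiff f.2).contDiffAt

/-- `δ^{(ℓ)}(x - τ)`, the functional `f ↦ f^{(ℓ)}(τ)`, as a linear map. -/
def deltaLin (ℓ : ℕ) (τ : ℂ) : EntireFunctions →ₗ[ℂ] ℂ where
  toFun f := iteratedDeriv ℓ f.1 τ
  map_add' f g :=
    iteratedDeriv_add (contDiffAt_entire f ℓ τ) (contDiffAt_entire g ℓ τ)
  map_smul' c f := iteratedDeriv_const_smul (contDiffAt_entire f ℓ τ) c

theorem continuous_deltaLin (ℓ : ℕ) (τ : ℂ) : Continuous (deltaLin ℓ τ) := by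
  refine continuous_of_continuousAt_zero (deltaLin ℓ τ) ?_
  have hK : CompactSpace (Metric.closedBall τ 1) :=
    isCompact_iff_compactSpace.1 (isCompact_closedBall τ 1)
  have hc : Continuous fun f : EntireFunctions =>
      (ℓ.factorial : ℝ) * ‖f.1.restrict (Metric.closedBall τ 1)‖ :=
    continuous_const.mul
      ((ContinuousMap.continuous_restrict (Metric.closedBall τ 1)).comp
        continuous_subtype_val).norm
  have h0 : Filter.Tendsto (fun f : EntireFunctions =>
      (ℓ.factorial : ℝ) * ‖f.1.restrict (Metric.closedBall τ 1)‖) (𝓝 0) (𝓝 0) := by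
    have := hc.tendsto 0
    have hz : ((0 : EntireFunctions) : C(ℂ, ℂ)).restrict (Metric.closedBall τ 1) = 0 := by
      ext z; rfl
    change Filter.Tendsto _ _ (𝓝 (_ * ‖ContinuousMap.restrict _ _‖)) at this
    rwa [hz, norm_zero, mul_zero] at this
  have hb : ∀ f : EntireFunctions,
      ‖deltaLin ℓ τ f‖ ≤ (ℓ.factorial : ℝ) * ‖f.1.restrict (Metric.closedBall τ 1)‖ := by
    intro f
    have := Complex.norm_iteratedDeriv_le_of_forall_mem_sphere_norm_le (f := f.1) (c := τ)
      (R := 1) (C := ‖f.1.restrict (Metric.closedBall τ 1)‖) ℓ one_pos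
      f.2.diffContOnCl
      (fun z hz => (f.1.restrict (Metric.closedBall τ 1)).norm_coe_le_norm
        ⟨z, Metric.sphere_subset_closedBall hz⟩)
    rw [one_pow, div_one] at this
    exact this
  have := squeeze_zero_norm hb h0
  simpa [ContinuousAt] using this

/-- `δ^{(ℓ)}(x - τ)`, normalised as `f ↦ f^{(ℓ)}(τ)`. -/
def deltaDeriv (ℓ : ℕ) (τ : ℂ) : AnalyticFunctional := ⟨deltaLin ℓ τ, continuous_deltaLin ℓ τ⟩

/-- The number of coordinates of `w` that are equal to `τ`. -/
def nodeMultiplicity {n : ℕ} (w : Fin n → ℂ) (τ : ℂ) : ℕ :=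
  (Finset.univ.filter fun i => w i = τ).card

/-- The space `V_w`, spanned by the `δ^{(ℓ)}(x - τ)` for `τ` a coordinate of `w` and `ℓ` smaller
than the multiplicity of `τ` in `w`. -/
def V {r : ℕ} (w : Fin r → ℂ) : Submodule ℂ AnalyticFunctional :=
  Submodule.span ℂ {T | ∃ (k : Fin r) (ℓ : ℕ), ℓ < nodeMultiplicity w (w k) ∧
    T = deltaDeriv ℓ (w k)}

/-- The total space of the bundle of the `V_w`, with the topology induced from
`ℂ^r × AnalyticFunctional`. -/
abbrev PronySpace (r : ℕ) : Type :=
  {p : (Fin r → ℂ) × AnalyticFunctional // p.2 ∈ V p.1}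

/-- The Newton polynomial `(X - x_1) ⋯ (X - x_j)` with the first `j` nodes. -/
def newtonPoly {n : ℕ} (x : Fin n → ℂ) (j : ℕ) (hj : j ≤ n) : ℂ[X] :=
  ∏ i : Fin j, (X - C (x (i.castLE hj)))

/-- The polynomial with Newton coefficients `c` (with respect to the nodes `x`). -/
def newtonForm {n : ℕ} (x c : Fin n → ℂ) : ℂ[X] :=
  ∑ j : Fin n, C (c j) * newtonPoly x j j.isLt.le

/-- `P` is the Hermite interpolation polynomial of `f` at the nodes `x`, repeated nodes being
interpolated to the order of their multiplicity. -/
def IsHermiteInterpolant {n : ℕ} (x : Fin n → ℂ) (f : ℂ → ℂ) (P : ℂ[X]) : Prop :=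
  P.degree < n ∧ ∀ (j : Fin n) (ℓ : ℕ), ℓ < nodeMultiplicity x (x j) →
    iteratedDeriv ℓ f (x j) = iteratedDeriv ℓ (fun z => P.eval z) (x j)

theorem newtonForm_succ {n : ℕ} (x c : Fin (n + 1) → ℂ) :
    newtonForm x c = newtonForm (Fin.init x) (Fin.init c) +
      C (c (Fin.last n)) * newtonPoly (Fin.init x) n le_rfl := by
  unfold newtonForm
  rw [Fin.sum_univ_castSucc]
  rfl

theorem newtonPoly_monic {n : ℕ} (x : Fin n → ℂ) (j : ℕ) (hj : j ≤ n) :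
    (newtonPoly x j hj).Monic := monic_prod_of_monic _ _ fun _ _ => monic_X_sub_C _

theorem newtonPoly_natDegree {n : ℕ} (x : Fin n → ℂ) (j : ℕ) (hj : j ≤ n) :
    (newtonPoly x j hj).natDegree = j := by
  unfold newtonPoly
  rw [natDegree_prod_of_monic _ _ fun _ _ => monic_X_sub_C _]
  simp

theorem degree_newtonForm_lt {n : ℕ} (x c : Fin n → ℂ) : (newtonForm x c).degree < n := by
  refine (degree_sum_le _ _).trans_lt ((Finset.sup_lt_iff (WithBot.bot_lt_coe n)).2 ?_)
  intro j _
  rw [← smul_eq_C_mul]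
  refine (degree_smul_le _ _).trans_lt ?_
  rw [degree_eq_natDegree (newtonPoly_monic x j _).ne_zero, newtonPoly_natDegree]
  exact Nat.cast_lt.2 j.isLt

theorem newtonForm_eq_zero : ∀ {n : ℕ} (x c : Fin n → ℂ), newtonForm x c = 0 → c = 0
  | 0, _, _, _ => Subsingleton.elim _ _
  | n + 1, x, c, h => by
    have hs := newtonForm_succ x c
    rw [h] at hs
    have hl : c (Fin.last n) = 0 := by
      have h1 := congrArg (fun p : ℂ[X] => p.coeff n) hs
      have h2 := (newtonPoly_monic (Fin.init x) n le_rfl).coeff_natDegree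
      rw [newtonPoly_natDegree] at h2
      simpa [coeff_eq_zero_of_degree_lt (degree_newtonForm_lt (Fin.init x) (Fin.init c)), h2]
        using h1.symm
    rw [hl, C_0, zero_mul, add_zero] at hs
    have h3 := newtonForm_eq_zero _ _ hs.symm
    funext j
    refine Fin.lastCases hl (fun i => ?_) j
    exact congrFun h3 i

theorem iteratedDeriv_polynomial (P : ℂ[X]) (ℓ : ℕ) :
    iteratedDeriv ℓ (fun z => P.eval z) = fun z => (derivative^[ℓ] P).eval z := by
  induction ℓ generalizing P with
  | zero => simp
  | succ k ih =>
    rw [iteratedDeriv_succ', Function.iterate_succ_apply, ← ih]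
    congr 1
    funext z
    exact P.deriv

/-- Uniqueness in Hermite interpolation. -/
theorem hermite_unique {n : ℕ} (x : Fin n → ℂ) (P : ℂ[X]) (hP : P.degree < n)
    (h : ∀ (j : Fin n) (ℓ : ℕ), ℓ < nodeMultiplicity x (x j) →
      iteratedDeriv ℓ (fun z => P.eval z) (x j) = 0) : P = 0 := by
  by_contra h0
  have hle : Multiset.map x Finset.univ.val ≤ P.roots := by
    rw [Multiset.le_iff_count]
    intro a
    have hc : Multiset.count a (Multiset.map x Finset.univ.val) = nodeMultiplicity x a := by
      rw [Multiset.count_map, nodeMultiplicity, Finset.card_def, Finset.filter_val]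
      simp only [eq_comm]
    rw [hc, count_roots]
    rcases Nat.eq_zero_or_pos (nodeMultiplicity x a) with hz | hpos
    · omega
    · obtain ⟨j, hj⟩ := Finset.card_pos.1 hpos
      have hj' : x j = a := (Finset.mem_filter.1 hj).2
      subst hj'
      have := (lt_rootMultiplicity_iff_isRoot_iterate_derivative (t := x j)
        (n := nodeMultiplicity x (x j) - 1) h0).2 (fun m hm => by
          have := h j m (by omega)
          rw [iteratedDeriv_polynomial] at this
          exact this)
      omega
  have h1 := Multiset.card_le_card hle
  have h2 := P.card_roots'
  have h3 : P.natDegree < n := (natDegree_lt_iff_degree_lt h0).2 hP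
  simp at h1
  omega

/-- Newton expansion with remainder. -/
theorem exists_newton_remainder : ∀ {n : ℕ} (x : Fin n → ℂ) (f : ℂ → ℂ), Differentiable ℂ f →
    ∃ (c : Fin n → ℂ) (g : ℂ → ℂ), Differentiable ℂ g ∧
      ∀ z, f z = (newtonForm x c).eval z + (∏ i, (z - x i)) * g z
  | 0, _, f, hf => ⟨Fin.elim0, f, hf, fun z => by simp [newtonForm]⟩
  | n + 1, x, f, hf => by
    obtain ⟨c, g, hg, h⟩ := exists_newton_remainder (Fin.init x) f hf
    refine ⟨Fin.snoc c (g (x (Fin.last n))), dslope g (x (Fin.last n)), ?_, fun z => ?_⟩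
    · rw [← differentiableOn_univ] at hg ⊢
      exact (Complex.differentiableOn_dslope Filter.univ_mem).2 hg
    · have hd : (z - x (Fin.last n)) * dslope g (x (Fin.last n)) z = g z - g (x (Fin.last n)) :=
        sub_smul_dslope g _ z
      have hq : (newtonPoly (Fin.init x) n le_rfl).eval z = ∏ i, (z - Fin.init x i) := by
        simp [newtonPoly, eval_prod]
      rw [newtonForm_succ, Fin.init_snoc, Fin.snoc_last, Fin.prod_univ_castSucc, h z, eval_add,
        eval_mul, eval_C, hq, mul_assoc, hd]
      simp only [Fin.init]
      ring

/-- Existence and uniqueness of the Hermite interpolation polynomial, in Newton form. -/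
theorem existsUnique_newtonCoeffs {n : ℕ} (x : Fin n → ℂ) (f : EntireFunctions) :
    ∃! c : Fin n → ℂ, IsHermiteInterpolant x f.1 (newtonForm x c) := by
  obtain ⟨c, g, hg, h⟩ := exists_newton_remainder x f.1 f.2
  have hpd : ∀ P : ℂ[X], ∀ (ℓ : ℕ) (a : ℂ), ContDiffAt ℂ ℓ (fun z => P.eval z) a :=
    fun P ℓ a => P.differentiable.contDiff.contDiffAt
  have hH : IsHermiteInterpolant x f.1 (newtonForm x c) := by
    refine ⟨degree_newtonForm_lt x c, fun j ℓ hℓ => ?_⟩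
    have hsub : (fun z => f.1 z - (newtonForm x c).eval z) =
        fun z => (∏ i, (z - x i)) * g z := by
      funext z; rw [h z]; ring
    have han : AnalyticAt ℂ (fun z => f.1 z - (newtonForm x c).eval z) (x j) :=
      (Differentiable.sub f.2 (newtonForm x c).differentiable).analyticAt _
    have hord : (nodeMultiplicity x (x j) : ℕ∞) ≤
        analyticOrderAt (fun z => f.1 z - (newtonForm x c).eval z) (x j) := by
      refine (natCast_le_analyticOrderAt han).2
        ⟨fun z => (∏ i ∈ Finset.univ.filter (fun i => ¬ x i = x j), (z - x i)) * g z, ?_, ?_⟩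
      · refine Differentiable.analyticAt (Differentiable.mul ?_ hg) _
        fun_prop
      · refine Filter.Eventually.of_forall fun z => ?_
        rw [congrFun hsub z,
          ← Finset.prod_filter_mul_prod_filter_not Finset.univ (fun i => x i = x j), smul_eq_mul,
          ← mul_assoc]
        congr 2
        rw [nodeMultiplicity, ← Finset.prod_const]
        exact Finset.prod_congr rfl fun i hi => by rw [(Finset.mem_filter.1 hi).2]
    have hz := (natCast_le_analyticOrderAt_iff_iteratedDeriv_eq_zero han).1 hord ℓ hℓ
    have hs := iteratedDeriv_fun_sub (contDiffAt_entire f ℓ _) (hpd (newtonForm x c) ℓ (x j))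
    rw [hz] at hs
    exact sub_eq_zero.1 hs.symm
  refine ⟨c, hH, fun c' hc' => ?_⟩
  have hlin : newtonForm x c' - newtonForm x c = newtonForm x (c' - c) := by
    simp [newtonForm, sub_mul, Finset.sum_sub_distrib]
  refine sub_eq_zero.1 (newtonForm_eq_zero x _ (hermite_unique x _ (degree_newtonForm_lt _ _) ?_))
  intro j ℓ hℓ
  rw [← hlin]
  simp only [eval_sub]
  rw [iteratedDeriv_fun_sub (hpd _ _ _) (hpd _ _ _), ← hc'.2 j ℓ hℓ, ← hH.2 j ℓ hℓ, sub_self]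

/-- The coefficients `c_1, …, c_n` in the Newton form `∑_j c_j (X - x_1) ⋯ (X - x_{j-1})` of the
Hermite interpolation polynomial of `f` at the nodes `x_1, …, x_n`. -/
def newtonCoeffs {n : ℕ} (x : Fin n → ℂ) (f : EntireFunctions) : Fin n → ℂ :=
  (existsUnique_newtonCoeffs x f).choose

theorem newtonCoeffs_spec {n : ℕ} (x : Fin n → ℂ) (f : EntireFunctions) :
    IsHermiteInterpolant x f.1 (newtonForm x (newtonCoeffs x f)) :=
  (existsUnique_newtonCoeffs x f).choose_spec.1

theorem newtonCoeffs_eq {n : ℕ} (x : Fin n → ℂ) (f : EntireFunctions) (c : Fin n → ℂ)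
    (h : IsHermiteInterpolant x f.1 (newtonForm x c)) : newtonCoeffs x f = c :=
  ((existsUnique_newtonCoeffs x f).choose_spec.2 c h).symm

theorem newtonForm_add {n : ℕ} (x c c' : Fin n → ℂ) :
    newtonForm x (c + c') = newtonForm x c + newtonForm x c' := by
  simp [newtonForm, add_mul, Finset.sum_add_distrib]

theorem newtonForm_smul {n : ℕ} (a : ℂ) (x c : Fin n → ℂ) :
    newtonForm x (a • c) = a • newtonForm x c := by
  simp [newtonForm, smul_eq_C_mul, Finset.mul_sum, mul_assoc]

/-- The Newton coefficients as a linear map. -/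
def newtonCoeffsLin {n : ℕ} (x : Fin n → ℂ) : EntireFunctions →ₗ[ℂ] (Fin n → ℂ) where
  toFun := newtonCoeffs x
  map_add' f g := newtonCoeffs_eq _ _ _ ⟨degree_newtonForm_lt _ _, fun j ℓ hℓ => by
    have h1 := (newtonCoeffs_spec x f).2 j ℓ hℓ
    have h2 := (newtonCoeffs_spec x g).2 j ℓ hℓ
    have h3 : iteratedDeriv ℓ (f + g).1 (x j) =
      iteratedDeriv ℓ f.1 (x j) + iteratedDeriv ℓ g.1 (x j) := (deltaLin ℓ (x j)).map_add f g
    rw [iteratedDeriv_polynomial] at h1 h2 ⊢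
    rw [h3, h1, h2, newtonForm_add]
    simp⟩
  map_smul' a f := newtonCoeffs_eq _ _ _ ⟨degree_newtonForm_lt _ _, fun j ℓ hℓ => by
    have h1 := (newtonCoeffs_spec x f).2 j ℓ hℓ
    have h3 : iteratedDeriv ℓ (a • f).1 (x j) = a • iteratedDeriv ℓ f.1 (x j) :=
      (deltaLin ℓ (x j)).map_smul a f
    rw [iteratedDeriv_polynomial] at h1 ⊢
    rw [h3, h1, RingHom.id_apply, newtonForm_smul]
    simp [iterate_derivative_smul]⟩

theorem continuous_newtonCoeffsLin {n : ℕ} (x : Fin n → ℂ) : Continuous (newtonCoeffsLin x) := by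
  classical
  -- the Hermite data of the polynomial with Newton coefficients `c`
  let D : (Fin n → ℂ) →ₗ[ℂ] (Fin n × Fin n → ℂ) :=
    { toFun := fun c p => if (p.2 : ℕ) < nodeMultiplicity x (x p.1) then
        (derivative^[p.2] (newtonForm x c)).eval (x p.1) else 0
      map_add' := fun c c' => by
        funext p
        by_cases h : (p.2 : ℕ) < nodeMultiplicity x (x p.1) <;> simp [h, newtonForm_add]
      map_smul' := fun a c => by
        funext p
        by_cases h : (p.2 : ℕ) < nodeMultiplicity x (x p.1) <;>
          simp [h, newtonForm_smul, iterate_derivative_smul] }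
  have hle : ∀ a, nodeMultiplicity x a ≤ n := fun a =>
    (Finset.card_filter_le _ _).trans (by simp)
  have hD : LinearMap.ker D = ⊥ := by
    refine LinearMap.ker_eq_bot'.2 fun c hc => newtonForm_eq_zero x c
      (hermite_unique x _ (degree_newtonForm_lt x c) fun j ℓ hℓ => ?_)
    have := congrFun hc (j, ⟨ℓ, hℓ.trans_le (hle _)⟩)
    rw [iteratedDeriv_polynomial]
    simpa [D, hℓ] using this
  obtain ⟨G, hG⟩ := LinearMap.exists_leftInverse_of_injective D hD
  have hdata : Continuous fun f : EntireFunctions => D (newtonCoeffsLin x f) := by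
    refine continuous_pi fun p => ?_
    by_cases h : (p.2 : ℕ) < nodeMultiplicity x (x p.1)
    · refine (continuous_deltaLin p.2 (x p.1)).congr fun f => ?_
      have h1 := (newtonCoeffs_spec x f).2 p.1 p.2 h
      rw [iteratedDeriv_polynomial] at h1
      simpa [D, h, deltaLin, newtonCoeffsLin] using h1
    · simpa [D, h] using continuous_const
  refine (G.continuous_of_finiteDimensional.comp hdata).congr fun f => ?_
  exact LinearMap.congr_fun hG (newtonCoeffsLin x f)

/-- The divided difference `Δ^{n-1}(x_1, …, x_n)`: the `n`-th (last) Newton coefficient of the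
Hermite interpolation polynomial at `x_1, …, x_n`. By convention it is `0` for `n = 0`. -/
def dividedDifference {n : ℕ} (x : Fin n → ℂ) : AnalyticFunctional :=
  if h : 0 < n then
    (ContinuousLinearMap.proj (R := ℂ) (φ := fun _ : Fin n => ℂ) ⟨n - 1, by omega⟩).comp
      ⟨newtonCoeffsLin x, continuous_newtonCoeffsLin x⟩
  else 0

/-- `Δ_X(w)`, the divided difference at the coordinates `x_n`, `n ∈ X`, in increasing order of
the indices. -/
def Delta {r : ℕ} (X : Finset (Fin r)) (w : Fin r → ℂ) : AnalyticFunctional :=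
  dividedDifference fun i => w (X.orderEmbOfFin rfl i)

/-- A configuration: a partition of the set of indices into nonempty disjoint blocks. -/
abbrev Configuration (r : ℕ) : Type := Finpartition (Finset.univ : Finset (Fin r))

/-- The pairs `(j, m)` of a block `X_j` of `C` and a position in that block. -/
abbrev Configuration.Index {r : ℕ} (C : Configuration r) : Type :=
  Σ X : C.parts, Fin (X : Finset (Fin r)).card

/-- The initial segment `X_{j,m}` of the block `X_j`, containing its smallest elements up to
position `m` (positions start at `0`). -/
def Configuration.segment {r : ℕ} (C : Configuration r) (i : C.Index) : Finset (Fin r) :=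
  (Finset.Iic i.2).map ((i.1 : Finset (Fin r)).orderEmbOfFin rfl).toEmbedding

/-- The family `B_C(w)` of the divided differences `Δ_{X_{j,m}}(w)`. -/
def Configuration.B {r : ℕ} (C : Configuration r) (i : C.Index) (w : Fin r → ℂ) :
    AnalyticFunctional :=
  Delta (C.segment i) w

/-- `w` is subordinated to `C`: equal coordinates have their indices in the same block. -/
def IsSubordinated {r : ℕ} (w : Fin r → ℂ) (C : Configuration r) : Prop :=
  ∀ k l : Fin r, k ≠ l → w k = w l → ∃ X ∈ C.parts, k ∈ X ∧ l ∈ X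

/-- The indexed family `v` is a basis of the subspace `W`. -/
def IsBasisOf {ι E : Type} [AddCommGroup E] [Module ℂ E] (v : ι → E) (W : Submodule ℂ E) : Prop :=
  ∃ b : Module.Basis ι ℂ W, ∀ i, (b i : E) = v i

/-- For `w ∈ U`, the functionals `B i w` form a basis of `V w`, and each `w ↦ (w, B i w)` is a
continuous section over `U` of the bundle of the `V w`. -/
def IsContinuousFamilyOfBases {r : ℕ} {ι : Type} (U : Set (Fin r → ℂ))
    (B : ι → (Fin r → ℂ) → AnalyticFunctional) : Prop :=
  (∀ w ∈ U, IsBasisOf (fun i => B i w) (V w)) ∧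
    ∀ i, ∃ σ : U → PronySpace r, Continuous σ ∧ ∀ w : U, (σ w).1 = ((w : Fin r → ℂ), B i w)

/-- The family `Δ_{N_1}(w), …, Δ_{N_r}(w)`, where `N_j` consists of the first `j` indices. -/
def newtonFamily {r : ℕ} (j : Fin r) (w : Fin r → ℂ) : AnalyticFunctional :=
  Delta (Finset.Iic j) w

end

/-! ### Divided slopes of entire functions -/

/-! The `m`-th Newton coefficient of `f` is an iterated divided slope of `f` (`newtonCoeffs_apply`),
and divided slopes extend across coinciding nodes. Two facts follow. At fixed nodes, the Newton
coefficients are dual to the Newton polynomials, hence independent. They have the same common kernel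
as the Hermite data, since either vanishes exactly when the interpolant is zero; hence they span `V
w`, which has dimension `r` even where nodes collide. As the nodes move, Cauchy's estimate makes the
coefficients Lipschitz, with a constant depending only on the supremum of `|f|` on a larger disc.
Bounded sets of entire functions have common suprema, so this is continuity in the strong topology.
For a configuration, the members of one block are the Newton coefficients at that block's nodes.
Under subordination each node keeps its full multiplicity in its block, so the `r` members span `V
w` and are a basis. If `x_k = x_l` in different blocks, one nonzero delta lies in the spans of two
disjoint subfamilies, contradicting independence. Subordination is an open condition, which gives
the neighbourhood. -/

theorem Differentiable.dslope {f : ℂ → ℂ} (hf : Differentiable ℂ f) (a : ℂ) :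
    Differentiable ℂ (dslope f a) := by
  rw [← differentiableOn_univ] at hf ⊢
  exact (Complex.differentiableOn_dslope Filter.univ_mem).2 hf

theorem dslope_comm (f : ℂ → ℂ) (a b : ℂ) : dslope f a b = dslope f b a := by
  rcases eq_or_ne a b with rfl | h
  · rfl
  · rw [dslope_of_ne f h.symm, dslope_of_ne f h, slope_comm]

theorem dslope_sub {f g : ℂ → ℂ} (hf : Differentiable ℂ f) (hg : Differentiable ℂ g) (a z : ℂ) :
    dslope (fun w => f w - g w) a z = dslope f a z - dslope g a z := by
  rcases eq_or_ne z a with rfl | h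
  · simp only [dslope_same]
    exact deriv_fun_sub (hf z) (hg z)
  · simp only [dslope_of_ne _ h, slope_def_field]
    ring

/-- Cauchy's estimate on concentric discs. -/
theorem norm_deriv_le_of_bound {f : ℂ → ℂ} (hf : Differentiable ℂ f) {R M : ℝ}
    (hM : ∀ z, ‖z‖ ≤ R + 1 → ‖f z‖ ≤ M) {z : ℂ} (hz : ‖z‖ ≤ R) : ‖deriv f z‖ ≤ M := by
  have := Complex.norm_deriv_le_of_forall_mem_sphere_norm_le (f := f) (c := z) (C := M) one_pos
    hf.diffContOnCl fun w hw => hM w <| by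
      have h1 : ‖w - z‖ = 1 := mem_sphere_iff_norm.1 hw
      have h2 := norm_add_le (w - z) z
      rw [sub_add_cancel] at h2
      linarith
  simpa using this

theorem norm_sub_le_of_bound {f : ℂ → ℂ} (hf : Differentiable ℂ f) {R M : ℝ}
    (hM : ∀ z, ‖z‖ ≤ R + 1 → ‖f z‖ ≤ M) {a b : ℂ} (ha : ‖a‖ ≤ R) (hb : ‖b‖ ≤ R) :
    ‖f b - f a‖ ≤ M * ‖b - a‖ :=
  Convex.norm_image_sub_le_of_norm_deriv_le (s := Metric.closedBall 0 R) (fun z _ => hf z)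
    (fun _ hz => norm_deriv_le_of_bound hf hM (mem_closedBall_zero_iff.1 hz))
    (convex_closedBall 0 R) (mem_closedBall_zero_iff.2 ha) (mem_closedBall_zero_iff.2 hb)

/-- The mean value inequality off the diagonal and Cauchy's estimate on it give the same bound, at
the cost of one unit of radius. -/
theorem norm_dslope_le_of_bound {f : ℂ → ℂ} (hf : Differentiable ℂ f) {R M : ℝ}
    (hM : ∀ z, ‖z‖ ≤ R + 1 → ‖f z‖ ≤ M) {a z : ℂ} (ha : ‖a‖ ≤ R) (hz : ‖z‖ ≤ R) :
    ‖dslope f a z‖ ≤ M := by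
  rcases eq_or_ne z a with rfl | h
  · rw [dslope_same]
    exact norm_deriv_le_of_bound hf hM hz
  · rw [dslope_of_ne f h, slope_def_field, norm_div,
      div_le_iff₀ (norm_pos_iff.2 (sub_ne_zero.2 h))]
    exact norm_sub_le_of_bound hf hM ha hz

/-- By symmetry of the slope, moving the base point amounts to moving the argument of the entire
function `dslope f z`. One unit of radius bounds that function, another its derivative. -/
theorem norm_dslope_sub_dslope_le {f : ℂ → ℂ} (hf : Differentiable ℂ f) {R M : ℝ}
    (hM : ∀ z, ‖z‖ ≤ R + 2 → ‖f z‖ ≤ M) {a b z : ℂ} (ha : ‖a‖ ≤ R) (hb : ‖b‖ ≤ R)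
    (hz : ‖z‖ ≤ R) : ‖dslope f a z - dslope f b z‖ ≤ M * ‖a - b‖ := by
  rw [dslope_comm f a, dslope_comm f b]
  refine norm_sub_le_of_bound (hf.dslope z) (fun w hw => ?_) hb ha
  exact norm_dslope_le_of_bound hf (fun v hv => hM v (by linarith)) (by linarith) hw

/-! ### The remainder in the Newton expansion -/

/-- The function `g` with `f = P + (z - x_1) ⋯ (z - x_n) g`, where `P` is the Hermite interpolation
polynomial of `f` at `x_1, …, x_n`; it is an iterated divided slope. -/
noncomputable def newtonRemainder (f : ℂ → ℂ) : ∀ {n : ℕ}, (Fin n → ℂ) → ℂ → ℂ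
  | 0, _ => f
  | n + 1, x => dslope (newtonRemainder f (Fin.init x)) (x (Fin.last n))

theorem differentiable_newtonRemainder {f : ℂ → ℂ} (hf : Differentiable ℂ f) :
    ∀ {n : ℕ} (x : Fin n → ℂ), Differentiable ℂ (newtonRemainder f x)
  | 0, _ => hf
  | _ + 1, x => (differentiable_newtonRemainder hf (Fin.init x)).dslope _

theorem newtonForm_add_newtonRemainder (f : ℂ → ℂ) : ∀ {n : ℕ} (x : Fin n → ℂ) (z : ℂ),
    f z = (newtonForm x fun j => newtonRemainder f (fun i : Fin j => x (i.castLE j.isLt.le))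
      (x j)).eval z + (∏ i, (z - x i)) * newtonRemainder f x z
  | 0, _, _ => by simp [newtonForm, newtonRemainder]
  | n + 1, x, z => by
    have ih := newtonForm_add_newtonRemainder f (Fin.init x) z
    have hd : (z - x (Fin.last n)) * newtonRemainder f x z =
        newtonRemainder f (Fin.init x) z - newtonRemainder f (Fin.init x) (x (Fin.last n)) :=
      sub_smul_dslope _ _ z
    have hq : (newtonPoly (Fin.init x) n le_rfl).eval z = ∏ i, (z - Fin.init x i) := by
      simp [newtonPoly, eval_prod]
    rw [newtonForm_succ, Fin.prod_univ_castSucc, eval_add, eval_mul, eval_C, hq, mul_assoc, hd]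
    refine ih.trans ?_
    -- The first `n` coefficients depend only on the first `n` nodes, so they agree definitionally
    -- with those of `Fin.init x`.
    change _ = eval z (newtonForm (Fin.init x) fun j => newtonRemainder f
      (fun i : Fin j => Fin.init x (i.castLE j.isLt.le)) (Fin.init x j)) +
      newtonRemainder f (Fin.init x) (x (Fin.last n)) * _ + (∏ i, (z - Fin.init x i)) * _
    ring

theorem isHermiteInterpolant_of_eq {n : ℕ} (x : Fin n → ℂ) {f g : ℂ → ℂ}
    (hf : Differentiable ℂ f) (hg : Differentiable ℂ g) {P : ℂ[X]} (hP : P.degree < n)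
    (h : ∀ z, f z = P.eval z + (∏ i, (z - x i)) * g z) : IsHermiteInterpolant x f P := by
  refine ⟨hP, fun j ℓ hℓ => ?_⟩
  have han : AnalyticAt ℂ (fun z => f z - P.eval z) (x j) := (hf.sub P.differentiable).analyticAt _
  have hord : (nodeMultiplicity x (x j) : ℕ∞) ≤ analyticOrderAt (fun z => f z - P.eval z) (x j) := by
    -- The factors whose node equals `x j` give the power of `z - x j`; the other factors join `g`
    -- as the cofactor.
    refine (natCast_le_analyticOrderAt han).2
      ⟨fun z => (∏ i ∈ Finset.univ.filter (fun i => ¬ x i = x j), (z - x i)) * g z, ?_, ?_⟩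
    · refine Differentiable.analyticAt (Differentiable.mul ?_ hg) _
      fun_prop
    · refine Filter.Eventually.of_forall fun z => ?_
      rw [h z, add_sub_cancel_left,
        ← Finset.prod_filter_mul_prod_filter_not Finset.univ (fun i => x i = x j), smul_eq_mul,
        ← mul_assoc]
      congr 2
      rw [nodeMultiplicity, ← Finset.prod_const]
      exact Finset.prod_congr rfl fun i hi => by rw [(Finset.mem_filter.1 hi).2]
  have hz := (natCast_le_analyticOrderAt_iff_iteratedDeriv_eq_zero han).1 hord ℓ hℓ
  rw [iteratedDeriv_fun_sub hf.contDiff.contDiffAt P.differentiable.contDiff.contDiffAt] at hz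
  exact sub_eq_zero.1 hz

/-- The Newton coefficients are values of iterated divided slopes. -/
theorem newtonCoeffs_apply {n : ℕ} (x : Fin n → ℂ) (f : EntireFunctions) (j : Fin n) :
    newtonCoeffs x f j =
      newtonRemainder f.1 (fun i : Fin j => x (i.castLE j.isLt.le)) (x j) :=
  congrFun (newtonCoeffs_eq x f _ (isHermiteInterpolant_of_eq x f.2
    (differentiable_newtonRemainder f.2 x) (degree_newtonForm_lt _ _)
    (newtonForm_add_newtonRemainder f.1 x))) j

theorem norm_newtonRemainder_le {f : ℂ → ℂ} (hf : Differentiable ℂ f) {M : ℝ} :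
    ∀ {n : ℕ} {x : Fin n → ℂ} {R : ℝ}, (∀ i, ‖x i‖ ≤ R) → (∀ z, ‖z‖ ≤ R + n → ‖f z‖ ≤ M) →
      ∀ z, ‖z‖ ≤ R → ‖newtonRemainder f x z‖ ≤ M
  | 0, _, _, _, hM => fun z hz => hM z (by simpa using hz)
  | n + 1, x, R, hx, hM => fun z hz =>
    norm_dslope_le_of_bound (differentiable_newtonRemainder hf _)
      (norm_newtonRemainder_le hf (fun i => (hx i.castSucc).trans (by linarith))
        fun w hw => hM w (by push_cast; linarith)) (hx _) hz

/-- Nodes are exchanged one at a time, each exchange costing `M * η`. -/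
theorem norm_newtonRemainder_sub_le {f : ℂ → ℂ} (hf : Differentiable ℂ f) {M η : ℝ} (hM0 : 0 ≤ M) :
    ∀ {n : ℕ} {x y : Fin n → ℂ} {R : ℝ}, (∀ i, ‖x i‖ ≤ R) → (∀ i, ‖y i‖ ≤ R) →
      (∀ i, ‖x i - y i‖ ≤ η) → (∀ z, ‖z‖ ≤ R + n + 1 → ‖f z‖ ≤ M) →
      ∀ z, ‖z‖ ≤ R → ‖newtonRemainder f x z - newtonRemainder f y z‖ ≤ n * (M * η)
  | 0, _, _, _, _, _, _, _ => fun z _ => by simp [newtonRemainder]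
  | n + 1, x, y, R, hx, hy, hxy, hM => fun z hz => by
    have dx := differentiable_newtonRemainder hf (Fin.init x)
    have dy := differentiable_newtonRemainder hf (Fin.init y)
    -- The last node stays at that of `x` while the others change: by linearity this is one slope of
    -- the difference of remainders, bounded by induction.
    have h1 := norm_dslope_le_of_bound (dx.sub dy) (norm_newtonRemainder_sub_le hf hM0
      (x := Fin.init x) (y := Fin.init y) (R := R + 1) (η := η)
      (fun i => (hx i.castSucc).trans (by linarith))
      (fun i => (hy i.castSucc).trans (by linarith)) (fun i => hxy i.castSucc)
      fun w hw => hM w (by push_cast; linarith)) (hx (Fin.last n)) hz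
    rw [show newtonRemainder f (Fin.init x) - newtonRemainder f (Fin.init y) =
      fun w => newtonRemainder f (Fin.init x) w - newtonRemainder f (Fin.init y) w from rfl,
      dslope_sub dx dy] at h1
    -- Now only the last node changes.
    have h2 := norm_dslope_sub_dslope_le dy (norm_newtonRemainder_le hf (M := M) (R := R + 2)
      (fun i => (hy i.castSucc).trans (by linarith))
      fun w hw => hM w (by push_cast; linarith)) (hx (Fin.last n)) (hy (Fin.last n)) hz
    have h3 := mul_le_mul_of_nonneg_left (hxy (Fin.last n)) hM0
    have h4 := norm_add_le_of_le h1 h2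
    rw [sub_add_sub_cancel] at h4
    refine h4.trans ?_
    push_cast
    linarith

/-! ### Newton coefficients as analytic functionals -/

/-- The `m`-th Newton coefficient at the nodes `x`, as an analytic functional. -/
noncomputable def newtonFunctional {n : ℕ} (x : Fin n → ℂ) (m : Fin n) : AnalyticFunctional :=
  (ContinuousLinearMap.proj (R := ℂ) (φ := fun _ : Fin n => ℂ) m).comp
    ⟨newtonCoeffsLin x, continuous_newtonCoeffsLin x⟩

theorem newtonFunctional_apply {n : ℕ} (x : Fin n → ℂ) (m : Fin n) (f : EntireFunctions) :
    newtonFunctional x m f = newtonCoeffs x f m := rfl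

theorem norm_newtonFunctional_sub_le {n : ℕ} {x y : Fin n → ℂ} {R M η : ℝ} (hM0 : 0 ≤ M)
    (hx : ∀ i, ‖x i‖ ≤ R) (hy : ∀ i, ‖y i‖ ≤ R) (hxy : ∀ i, ‖x i - y i‖ ≤ η)
    {f : EntireFunctions} (hM : ∀ z, ‖z‖ ≤ R + n + 1 → ‖f.1 z‖ ≤ M) (m : Fin n) :
    ‖newtonFunctional x m f - newtonFunctional y m f‖ ≤ (n + 1) * (M * η) := by
  have hη : 0 ≤ M * η := mul_nonneg hM0 ((norm_nonneg _).trans (hxy m))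
  have hmn : ((m : ℕ) : ℝ) ≤ n := by exact_mod_cast m.isLt.le
  -- The first `m` nodes move here, the evaluation point in `h2`; together at most `m + 1 ≤ n + 1`
  -- exchanges.
  have h1 := norm_newtonRemainder_sub_le f.2 hM0 (x := fun i : Fin m => x (i.castLE m.isLt.le))
    (y := fun i : Fin m => y (i.castLE m.isLt.le)) (fun i => hx _) (fun i => hy _)
    (fun i => hxy _) (fun z hz => hM z (by linarith)) (x m) (hx m)
  have h2 := norm_sub_le_of_bound (differentiable_newtonRemainder f.2 _)
    (norm_newtonRemainder_le f.2 (M := M) (R := R + 1)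
      (x := fun i : Fin m => y (i.castLE m.isLt.le)) (fun i => (hy _).trans (by linarith))
      fun z hz => hM z (by linarith)) (hy m) (hx m)
  have h3 := mul_le_mul_of_nonneg_left (hxy m) hM0
  have h4 := mul_le_mul_of_nonneg_right hmn hη
  rw [newtonFunctional_apply, newtonFunctional_apply, newtonCoeffs_apply, newtonCoeffs_apply]
  have h5 := norm_add_le_of_le h1 h2
  rw [sub_add_sub_cancel] at h5
  linarith

/-- A bounded set of entire functions is uniformly bounded on every disc. -/
theorem exists_bound_of_isVonNBounded {S : Set EntireFunctions} (hS : Bornology.IsVonNBounded ℂ S)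
    (R : ℝ) : ∃ M, 0 ≤ M ∧ ∀ f ∈ S, ∀ z, ‖z‖ ≤ R → ‖f.1 z‖ ≤ M := by
  have hK : CompactSpace (Metric.closedBall (0 : ℂ) R) :=
    isCompact_iff_compactSpace.1 (isCompact_closedBall _ _)
  let L : EntireFunctions →L[ℂ] C(Metric.closedBall (0 : ℂ) R, ℂ) :=
    { toFun f := f.1.restrict (Metric.closedBall 0 R)
      map_add' _ _ := rfl
      map_smul' _ _ := rfl
      cont := (ContinuousMap.continuous_restrict _).comp continuous_subtype_val }
  obtain ⟨M, hM⟩ := ((NormedSpace.isVonNBounded_iff ℂ).1 (hS.image L)).exists_norm_le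
  refine ⟨max M 0, le_max_right _ _, fun f hf z hz => le_max_of_le_left ?_⟩
  exact ((L f).norm_coe_le_norm ⟨z, mem_closedBall_zero_iff.2 hz⟩).trans
    (hM _ (Set.mem_image_of_mem L hf))

theorem continuous_newtonFunctional {n : ℕ} (m : Fin n) :
    Continuous fun x : Fin n → ℂ => newtonFunctional x m := by
  refine continuous_iff_continuousAt.2 fun x => ?_
  refine (UniformConvergenceCLM.tendsto_iff_tendstoUniformlyOn (RingHom.id ℂ) ℂ
    {S : Set EntireFunctions | Bornology.IsVonNBounded ℂ S}).2 fun S hS => ?_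
  obtain ⟨M, hM0, hM⟩ := exists_bound_of_isVonNBounded hS (‖x‖ + 1 + n + 1)
  refine Metric.tendstoUniformlyOn_iff.2 fun ε hε => ?_
  -- `M + 1` replaces `M` so that the divisor is positive even if `M = 0`.
  have hc : 0 < ((n : ℝ) + 1) * (M + 1) := by positivity
  filter_upwards [Metric.ball_mem_nhds x (lt_min one_pos (div_pos hε hc))] with y hy f hf
  rw [mem_ball_iff_norm'] at hy
  have hyx : ‖y‖ ≤ ‖x‖ + 1 := by
    have := norm_sub_norm_le y x
    rw [norm_sub_rev] at this
    linarith [hy.trans_le (min_le_left _ _)]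
  have h1 := norm_newtonFunctional_sub_le hM0 (R := ‖x‖ + 1) (η := ‖x - y‖)
    (fun i => (norm_le_pi_norm x i).trans (by linarith))
    (fun i => (norm_le_pi_norm y i).trans hyx) (fun i => norm_le_pi_norm (x - y) i) (hM f hf) m
  refine (dist_eq_norm _ _).trans_lt (h1.trans_lt ?_)
  have h2 := (lt_div_iff₀ hc).1 (hy.trans_le (min_le_right _ _))
  have h3 : 0 ≤ ((n : ℝ) + 1) * ‖x - y‖ := by positivity
  nlinarith

/-! ### The Newton functionals form a basis -/

/-- A polynomial as an entire function. -/
noncomputable def polynomialEntire (P : ℂ[X]) : EntireFunctions :=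
  ⟨⟨fun z => P.eval z, P.continuous⟩, P.differentiable⟩

theorem newtonCoeffs_newtonForm {n : ℕ} (x c : Fin n → ℂ) :
    newtonCoeffs x (polynomialEntire (newtonForm x c)) = c :=
  newtonCoeffs_eq _ _ _ ⟨degree_newtonForm_lt x c, fun _ _ _ => rfl⟩

theorem deltaDeriv_apply (ℓ : ℕ) (τ : ℂ) (f : EntireFunctions) :
    deltaDeriv ℓ τ f = iteratedDeriv ℓ f.1 τ := rfl

theorem nodeMultiplicity_pos {n : ℕ} (x : Fin n → ℂ) (k : Fin n) :
    0 < nodeMultiplicity x (x k) :=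
  Finset.card_pos.2 ⟨k, by simp⟩

theorem linearIndependent_newtonFunctional {n : ℕ} (x : Fin n → ℂ) :
    LinearIndependent ℂ (newtonFunctional x) := by
  refine Fintype.linearIndependent_iff.2 fun g hg i => ?_
  have := DFunLike.congr_fun hg (polynomialEntire (newtonForm x (Pi.single i 1)))
  simpa [sum_apply, newtonFunctional_apply, newtonCoeffs_newtonForm,
    Pi.single_apply] using this

/-- A functional killing the common kernel of finitely many functionals is in their span. -/
theorem mem_span_range_of_forall_eq_zero {ι : Type*} [Finite ι] (L : ι → AnalyticFunctional)
    (K : AnalyticFunctional) (h : ∀ f, (∀ i, L i f = 0) → K f = 0) :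
    K ∈ Submodule.span ℂ (Set.range L) := by
  -- The kernel criterion lives in the algebraic dual; injectivity of the coercion brings its
  -- conclusion back.
  let φ : AnalyticFunctional →ₗ[ℂ] EntireFunctions →ₗ[ℂ] ℂ := ContinuousLinearMap.coeLM ℂ
  have hφ : Function.Injective φ := ContinuousLinearMap.coe_injective
  have h1 : φ K ∈ Submodule.span ℂ (Set.range (φ ∘ L)) := by
    refine mem_span_of_iInf_ker_le_ker (L := φ ∘ L) fun f hf => h f fun i => ?_
    exact (Submodule.mem_iInf _).1 hf i
  rw [Set.range_comp, ← Submodule.map_span] at h1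
  obtain ⟨K', hK', he⟩ := h1
  rwa [← hφ he]

/-- Each inclusion compares kernels: zero Hermite data force a zero interpolant, and zero
coefficients give zero Hermite data. -/
theorem span_newtonFunctional {n : ℕ} (x : Fin n → ℂ) :
    Submodule.span ℂ (Set.range (newtonFunctional x)) = V x := by
  refine le_antisymm (Submodule.span_le.2 ?_) (Submodule.span_le.2 ?_)
  · rintro _ ⟨m, rfl⟩
    let I := Σ k : Fin n, Fin (nodeMultiplicity x (x k))
    have h : newtonFunctional x m ∈
        Submodule.span ℂ (Set.range fun p : I => deltaDeriv p.2 (x p.1)) := by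
      refine mem_span_range_of_forall_eq_zero _ _ fun f hf => ?_
      have h0 : newtonForm x (newtonCoeffs x f) = 0 :=
        hermite_unique x _ (degree_newtonForm_lt _ _) fun j ℓ hℓ =>
          ((newtonCoeffs_spec x f).2 j ℓ hℓ).symm.trans (hf ⟨j, ℓ, hℓ⟩)
      exact congrFun (newtonForm_eq_zero x _ h0) m
    refine Submodule.span_mono ?_ h
    rintro _ ⟨p, rfl⟩
    exact ⟨p.1, p.2, p.2.isLt, rfl⟩
  · rintro _ ⟨k, ℓ, hℓ, rfl⟩
    refine mem_span_range_of_forall_eq_zero _ _ fun f hf => ?_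
    have hc : newtonCoeffs x f = 0 := funext hf
    have h1 := (newtonCoeffs_spec x f).2 k ℓ hℓ
    rw [iteratedDeriv_polynomial, hc] at h1
    rw [deltaDeriv_apply, h1]
    simp [newtonForm]

theorem finrank_V {n : ℕ} (x : Fin n → ℂ) : Module.finrank ℂ (V x) = n := by
  rw [← span_newtonFunctional, finrank_span_eq_card (linearIndependent_newtonFunctional x),
    Fintype.card_fin]

theorem isBasisOf_iff {ι E : Type} [AddCommGroup E] [Module ℂ E] {v : ι → E} {W : Submodule ℂ E} :
    IsBasisOf v W ↔ LinearIndependent ℂ v ∧ Submodule.span ℂ (Set.range v) = W := by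
  constructor
  · rintro ⟨b, hb⟩
    have hv : v = W.subtype ∘ b := funext fun i => (hb i).symm
    refine ⟨hv ▸ b.linearIndependent.map' _ W.ker_subtype, ?_⟩
    rw [hv, Set.range_comp, ← Submodule.map_span, b.span_eq, Submodule.map_subtype_top]
  · rintro ⟨hli, rfl⟩
    exact ⟨Module.Basis.span hli, fun i => by rw [Module.Basis.span_apply]⟩

theorem isBasisOf_newtonFunctional {n : ℕ} (x : Fin n → ℂ) :
    IsBasisOf (newtonFunctional x) (V x) :=
  isBasisOf_iff.2 ⟨linearIndependent_newtonFunctional x, span_newtonFunctional x⟩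

/-! ### Divided differences over initial segments -/

/-- A Newton coefficient ignores all nodes after its own. -/
theorem newtonFunctional_castLE {n k : ℕ} (h : k ≤ n) (x : Fin n → ℂ) (m : Fin k) :
    newtonFunctional (fun i => x (i.castLE h)) m = newtonFunctional x (m.castLE h) := by
  ext f
  rw [newtonFunctional_apply, newtonFunctional_apply, newtonCoeffs_apply, newtonCoeffs_apply]
  rfl

theorem dividedDifference_eq {n : ℕ} (x : Fin (n + 1) → ℂ) :
    dividedDifference x = newtonFunctional x (Fin.last n) := rfl

theorem Delta_eq_dividedDifference {r k : ℕ} (X : Finset (Fin r)) (h : X.card = k)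
    (w : Fin r → ℂ) : Delta X w = dividedDifference fun i => w (X.orderEmbOfFin h i) := by
  subst h
  rfl

/-- This turns divided differences over initial segments into the coefficients of a single
interpolation problem. Positions start at `0`, so the segment has `m + 1` elements. -/
theorem Delta_map_Iic {n r : ℕ} (e : Fin n ↪o Fin r) (m : Fin n) (w : Fin r → ℂ) :
    Delta ((Finset.Iic m).map e.toEmbedding) w = newtonFunctional (fun i => w (e i)) m := by
  have hk : ((Finset.Iic m).map e.toEmbedding).card = m + 1 := by simp
  have he : (fun i : Fin (m + 1) => e (i.castLE m.isLt)) =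
      ((Finset.Iic m).map e.toEmbedding).orderEmbOfFin hk := by
    refine Finset.orderEmbOfFin_unique hk (fun i => ?_)
      (e.strictMono.comp (Fin.strictMono_castLE m.isLt))
    refine Finset.mem_map_of_mem _ (Finset.mem_Iic.2 (Fin.le_def.2 ?_))
    exact Nat.lt_succ_iff.1 i.isLt
  rw [Delta_eq_dividedDifference _ hk, ← he, dividedDifference_eq,
    newtonFunctional_castLE m.isLt (fun i => w (e i))]
  rfl

theorem newtonFamily_eq {r : ℕ} (j : Fin r) (w : Fin r → ℂ) :
    newtonFamily j w = newtonFunctional w j := by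
  have := Delta_map_Iic (RelEmbedding.refl (· ≤ ·) : Fin r ↪o Fin r) j w
  rw [show (RelEmbedding.refl (· ≤ ·) : Fin r ↪o Fin r).toEmbedding = Function.Embedding.refl _
    from rfl, Finset.map_refl] at this
  exact this

/-! ### Bases attached to configurations -/

namespace Configuration

variable {r : ℕ} (C : Configuration r)

/-- The nodes of `w` with index in `X`, in increasing order of the indices. -/
abbrev nodes (X : Finset (Fin r)) (w : Fin r → ℂ) : Fin X.card → ℂ :=
  fun i => w (X.orderEmbOfFin rfl i)

theorem B_eq (i : C.Index) (w : Fin r → ℂ) :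
    C.B i w = newtonFunctional (nodes i.1 w) i.2 :=
  Delta_map_Iic _ _ _

theorem continuous_B (i : C.Index) : Continuous (C.B i) := by
  rw [show C.B i = fun w => newtonFunctional (nodes i.1 w) i.2 from funext (C.B_eq i)]
  exact (continuous_newtonFunctional i.2).comp (continuous_pi fun _ => continuous_apply _)

theorem card_index : Fintype.card C.Index = r := by
  rw [Fintype.card_sigma]
  simp only [Fintype.card_fin]
  rw [Finset.sum_coe_sort C.parts Finset.card, C.sum_card_parts, Finset.card_univ, Fintype.card_fin]

/-- The span is kept to a single block because the converse direction needs disjoint subfamilies. -/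
theorem V_nodes_le_span (w : Fin r → ℂ) (X : C.parts) :
    V (nodes X w) ≤ Submodule.span ℂ ((fun i : C.Index => C.B i w) '' {i | i.1 = X}) := by
  rw [← span_newtonFunctional]
  refine Submodule.span_mono ?_
  rintro _ ⟨m, rfl⟩
  exact ⟨⟨X, m⟩, rfl, C.B_eq ⟨X, m⟩ w⟩

theorem exists_orderEmbOfFin_eq {X : Finset (Fin r)} {k : Fin r} (hk : k ∈ X) :
    ∃ j, X.orderEmbOfFin rfl j = k := by
  rw [← Set.mem_range, Finset.range_orderEmbOfFin]
  exact hk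

/-- In a block of a configuration to which `w` is subordinated, nodes keep their multiplicity. -/
theorem nodeMultiplicity_nodes {w : Fin r → ℂ} (hw : IsSubordinated w C) {X : Finset (Fin r)}
    (hX : X ∈ C.parts) {k : Fin r} (hk : k ∈ X) :
    nodeMultiplicity (nodes X w) (w k) = nodeMultiplicity w (w k) := by
  unfold nodeMultiplicity
  rw [← Finset.card_map (X.orderEmbOfFin rfl).toEmbedding]
  congr 1
  ext l
  simp only [Finset.mem_map, Finset.mem_filter, Finset.mem_univ, true_and]
  constructor
  · rintro ⟨i, hi, rfl⟩
    exact hi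
  · intro hl
    have hlX : l ∈ X := by
      by_cases hkl : k = l
      · exact hkl ▸ hk
      · obtain ⟨Y, hY, hkY, hlY⟩ := hw k l hkl hl.symm
        rwa [C.eq_of_mem_parts hX hY hk hkY]
    obtain ⟨j, rfl⟩ := exists_orderEmbOfFin_eq hlX
    exact ⟨j, hl, rfl⟩

theorem V_le_span {w : Fin r → ℂ} (hw : IsSubordinated w C) :
    V w ≤ Submodule.span ℂ (Set.range fun i : C.Index => C.B i w) := by
  refine Submodule.span_le.2 ?_
  rintro _ ⟨k, ℓ, hℓ, rfl⟩
  obtain ⟨X, hX, hk⟩ := C.exists_mem (Finset.mem_univ k)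
  rw [← C.nodeMultiplicity_nodes hw hX hk] at hℓ
  obtain ⟨j, rfl⟩ := exists_orderEmbOfFin_eq hk
  exact Submodule.span_mono (Set.image_subset_range _ _)
    (C.V_nodes_le_span w ⟨X, hX⟩ (Submodule.subset_span ⟨j, ℓ, hℓ, rfl⟩))

/-- A spanning inclusion suffices: the family has `r` members and `V w` has dimension `r`. -/
theorem isBasisOf_B {w : Fin r → ℂ} (hw : IsSubordinated w C) :
    IsBasisOf (fun i : C.Index => C.B i w) (V w) := by
  have hfin : Module.Finite ℂ (Submodule.span ℂ (Set.range fun i : C.Index => C.B i w)) :=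
    Module.Finite.span_of_finite ℂ (Set.finite_range _)
  have hle := finrank_range_le_card (R := ℂ) fun i : C.Index => C.B i w
  rw [C.card_index] at hle
  have heq : V w = Submodule.span ℂ (Set.range fun i : C.Index => C.B i w) :=
    Submodule.eq_of_le_of_finrank_le (C.V_le_span hw) (by rw [finrank_V]; exact hle)
  refine isBasisOf_iff.2 ⟨linearIndependent_iff_card_eq_finrank_span.2 ?_, heq.symm⟩
  rw [C.card_index, Set.finrank, ← heq, finrank_V]

theorem isSubordinated_of_linearIndependent {w : Fin r → ℂ}
    (h : LinearIndependent ℂ fun i : C.Index => C.B i w) : IsSubordinated w C := by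
  intro k l _ hkl
  obtain ⟨X, hX, hk⟩ := C.exists_mem (Finset.mem_univ k)
  obtain ⟨Y, hY, hl⟩ := C.exists_mem (Finset.mem_univ l)
  have hmem : ∀ {Z : Finset (Fin r)} (hZ : Z ∈ C.parts) {m : Fin r}, m ∈ Z →
      deltaDeriv 0 (w m) ∈
        Submodule.span ℂ ((fun i : C.Index => C.B i w) '' {i | i.1 = ⟨Z, hZ⟩}) := by
    intro Z hZ m hm
    obtain ⟨j, rfl⟩ := exists_orderEmbOfFin_eq hm
    exact C.V_nodes_le_span w ⟨Z, hZ⟩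
      (Submodule.subset_span ⟨j, 0, nodeMultiplicity_pos (nodes Z w) j, rfl⟩)
  by_cases hXY : X = Y
  · exact ⟨X, hX, hk, hXY ▸ hl⟩
  · have hd : Disjoint {i : C.Index | i.1 = ⟨X, hX⟩} {i : C.Index | i.1 = ⟨Y, hY⟩} :=
      Set.disjoint_left.2 fun i hi hi' => hXY (congrArg Subtype.val (hi.symm.trans hi'))
    have h0 := Submodule.disjoint_def.1 (h.disjoint_span_image hd) _ (hmem hX hk)
      (hkl ▸ hmem hY hl)
    -- The delta would vanish, yet it takes the value `1` on the constant `1`.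
    have h1 := DFunLike.congr_fun h0 (polynomialEntire 1)
    simp [deltaDeriv_apply, polynomialEntire] at h1

/-- Subordination is a finite conjunction of conditions `w k ≠ w l`, over pairs in different blocks.
-/
theorem isOpen_setOf_isSubordinated : IsOpen {w : Fin r → ℂ | IsSubordinated w C} := by
  simp only [IsSubordinated, Set.ofPred_forall]
  refine isOpen_iInter_of_finite fun k => isOpen_iInter_of_finite fun l =>
    isOpen_iInter_of_finite fun _ => ?_
  by_cases h : ∃ X ∈ C.parts, k ∈ X ∧ l ∈ X
  · simp [h]
  · simp only [h, imp_false]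
    exact isOpen_ne_fun (continuous_apply k) (continuous_apply l)

/-- If there is only one block, the segments are the initial segments of `{1, …, r}`. -/
theorem exists_index_equiv (h : C.parts = {Finset.univ}) :
    ∃ e : C.Index ≃ Fin r, ∀ i, C.segment i = Finset.Iic (e i) := by
  have huniv : ∀ X : C.parts, (X : Finset (Fin r)) = Finset.univ := fun X =>
    Finset.mem_singleton.1 (h ▸ X.2)
  have hmem : ∀ (X : C.parts) (a : Fin r), a ∈ (X : Finset (Fin r)) := fun X a => by
    rw [huniv X]
    exact Finset.mem_univ a
  refine ⟨Equiv.ofBijective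
    (fun i : C.Index => (i.1 : Finset (Fin r)).orderEmbOfFin rfl i.2) ⟨?_, fun a => ?_⟩,
    fun ⟨X, m⟩ => ?_⟩
  · rintro ⟨X, m⟩ ⟨Y, m'⟩ he
    obtain rfl : X = Y := Subtype.ext ((huniv X).trans (huniv Y).symm)
    obtain rfl : m = m' := (RelEmbedding.injective _) he
    rfl
  · obtain ⟨m, hm⟩ := exists_orderEmbOfFin_eq (hmem ⟨Finset.univ, by simp [h]⟩ a)
    exact ⟨⟨_, m⟩, hm⟩
  · ext a
    obtain ⟨j, rfl⟩ := exists_orderEmbOfFin_eq (hmem X a)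
    simp only [segment, Finset.mem_map, Finset.mem_Iic,
      RelEmbedding.coe_toEmbedding, EmbeddingLike.apply_eq_iff_eq, exists_eq_right]
    exact (OrderEmbedding.le_iff_le _).symm

end Configuration

/-! ### Continuous sections and the main theorem -/

theorem isContinuousFamilyOfBases_of_continuous {r : ℕ} {ι : Type} {U : Set (Fin r → ℂ)}
    {B : ι → (Fin r → ℂ) → AnalyticFunctional} (hB : ∀ i, Continuous (B i))
    (h : ∀ w ∈ U, IsBasisOf (fun i => B i w) (V w)) : IsContinuousFamilyOfBases U B := by
  refine ⟨h, fun i => ⟨fun w => ⟨((w : Fin r → ℂ), B i w), ?_⟩, ?_, fun w => rfl⟩⟩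
  · exact (isBasisOf_iff.1 (h w w.2)).2.le (Submodule.subset_span ⟨i, rfl⟩)
  · exact Continuous.subtype_mk
      (continuous_subtype_val.prodMk ((hB i).comp continuous_subtype_val)) _

theorem mainTheorem3 (r : ℕ) (w₀ : Fin r → ℂ) (C : Configuration r) :
    (IsBasisOf (fun i : C.Index => C.B i w₀) (V w₀) ↔ IsSubordinated w₀ C) ∧
    (IsSubordinated w₀ C →
      ∃ U : Set (Fin r → ℂ), IsOpen U ∧ w₀ ∈ U ∧ IsContinuousFamilyOfBases U C.B) ∧
    IsContinuousFamilyOfBases Set.univ (newtonFamily (r := r)) ∧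
    (C.parts = {Finset.univ} →
      ∃ e : C.Index ≃ Fin r, ∀ i : C.Index, C.segment i = Finset.Iic (e i) ∧
        C.B i = newtonFamily (e i)) := by
  refine ⟨⟨fun h => C.isSubordinated_of_linearIndependent (isBasisOf_iff.1 h).1, C.isBasisOf_B⟩,
    -- The neighbourhood is the whole set of subordinated points, independent of `w₀`.
    fun h => ⟨{w | IsSubordinated w C}, C.isOpen_setOf_isSubordinated, h,
      isContinuousFamilyOfBases_of_continuous C.continuous_B fun _ hw => C.isBasisOf_B hw⟩,
    isContinuousFamilyOfBases_of_continuous (fun j => ?_) fun w _ => ?_, fun h => ?_⟩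
  · rw [show newtonFamily j = fun w => newtonFunctional w j from funext (newtonFamily_eq j)]
    exact continuous_newtonFunctional j
  · simp only [newtonFamily_eq]
    exact isBasisOf_newtonFunctional w
  · obtain ⟨e, he⟩ := C.exists_index_equiv h
    refine ⟨e, fun i => ⟨he i, funext fun w => ?_⟩⟩
    rw [Configuration.B, he i]
    rfl
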